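/- Let $\mathcal H=\mathcal H_1\otimes\cdots\otimes\mathcal H_n$ be an $n$-partite system with finite-dimensional complex Hilbert spaces $\mathcal H_k$, and let $\rho$ be a state (density operator) on $\mathcal H$. A POVM is a finite family $M=(M_i)_i$ of positive semidefinite operators with $\sum_i M_i=\mathbb 1$. Its observational entropy is $S_M(\rho)=-\sum_i p_i\log(p_i/V_i)$ with $p_i=\operatorname{Tr}(\rho M_i)$ and $V_i=\operatorname{Tr}M_i$ (terms with $p_i=0$ are $0$; $\log$ is the natural logarithm, and any other base rescales every quantity below by the same constant). For a set $\chi$ of POVMs on $\mathcal H$ the entropy gap is $E_\chi(\rho)=\inf_{M\in\chi}S_M(\rho)-S(\rho)$, where $S(\rho)=-\operatorname{Tr}\rho\log\rho$. Consider the following classes of POVMs: - $\mathrm{LO}^*$: tensor products $\Pi^{(1)}\otimes\cdots\otimes\Pi^{(n)}=(\Pi^{(1)}_{i_1}\otimes\cdots\otimes\Pi^{(n)}_{i_n})_{i_1,\dots,i_n}$ of projective measurements $\Pi^{(k)}$ on $\mathcal H_k$ (i.e. POVMs with $\Pi^{(k)}_i\Pi^{(k)}_j=\delta_{ij}\Pi^{(k)}_i$);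 - $\mathrm{SEP}$: POVMs each of whose elements is a finite sum of tensor products $A^{(1)}\otimes\cdots\otimes A^{(n)}$ of positive semidefinite operators $A^{(k)}$ on $\mathcal H_k$; - $\mathrm{PPT}$: POVMs each of whose elements has positive semidefinite partial transpose with respect to every subset of the parties. Let $D(\rho\|\sigma)=\operatorname{Tr}\rho(\log\rho-\log\sigma)$ if $\operatorname{supp}\rho\subseteq\operatorname{supp}\sigma$ and $D(\rho\|\sigma)=+\infty$ otherwise. Define $\Delta_{\mathrm{REQ}}(\rho)$, $\Delta_{\mathrm{REE}}(\rho)$ and $\Delta_{\mathrm{REE,PPT}}(\rho)$ as the infimum of $D(\rho\|\sigma)$ over, respectively, the classically correlated states $\sigma$ (those of the form $\sum_{i_1,\dots,i_n}p_{i_1\dots i_n}|\psi^{(1)}_{i_1}\cdots\psi^{(n)}_{i_n}\rangle\langle\psi^{(1)}_{i_1}\cdots\psi^{(n)}_{i_n}|$ with orthonormal bases $(\psi^{(k)}_i)_i$ of $\mathcal H_k$ and a probability distribution $p$), the separable states $\sigma$ (finite convex combinations of product states), and the states $\sigma$ whose partial transpose with respect to every subset of the parties is positive semidefinite. Theorem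 (REQ and REE). For every such state $\rho$, $$E_{\mathrm{LO}^*}(\rho)=\Delta_{\mathrm{REQ}}(\rho),\qquad E_{\mathrm{SEP}}(\rho)\ge\Delta_{\mathrm{REE}}(\rho),\qquad E_{\mathrm{PPT}}(\rho)\ge\Delta_{\mathrm{REE,PPT}}(\rho).$$ -/

import Mathlib

noncomputable section

namespace EntropyGap

open Matrix
open scoped ComplexOrder

/-! ### States, measurements and entropies on a finite-dimensional Hilbert space

The Hilbert space is `ℂ^X` for a finite index set `X`, and operators are matrices. -/

section General

variable {X : Type} [Fintype X] [DecidableEq X]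

/-- Density operators: positive semidefinite with unit trace. -/
def IsState (ρ : Matrix X X ℂ) : Prop :=
  ρ.PosSemidef ∧ ρ.trace = 1

/-- The operator `|v⟩⟨v|`. -/
def ketbra (v : X → ℂ) : Matrix X X ℂ :=
  Matrix.vecMulVec v (star v)

/-- A POVM with finitely many outcomes. -/
structure POVM (X : Type) [Fintype X] [DecidableEq X] where
  Outcome : Type
  [fintypeOutcome : Fintype Outcome]
  op : Outcome → Matrix X X ℂ
  posSemidef : ∀ i, (op i).PosSemidef
  sum_op : ∑ i, op i = 1

attribute [instance] POVM.fintypeOutcome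

namespace POVM

/-- Projective measurements: `Π_i Π_j = δ_{ij} Π_i`. -/
def IsProjective (M : POVM X) : Prop :=
  (∀ i, M.op i * M.op i = M.op i) ∧ ∀ i j, i ≠ j → M.op i * M.op j = 0

/-- The outcome probability `p_i = Tr (ρ M_i)`. -/
def prob (M : POVM X) (ρ : Matrix X X ℂ) (i : M.Outcome) : ℝ :=
  (ρ * M.op i).trace.re

/-- The macrostate volume `V_i = Tr M_i`. -/
def volume (M : POVM X) (i : M.Outcome) : ℝ :=
  (M.op i).trace.re

/-- Observational entropy `S_M(ρ) = -∑ p_i log (p_i / V_i)`, where outcomes with `p_i = 0`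
(in particular those with `V_i = 0`) contribute `0`. -/
def obsEntropy (M : POVM X) (ρ : Matrix X X ℂ) : ℝ :=
  -∑ i, M.prob ρ i * Real.log (M.prob ρ i / M.volume i)

end POVM

/-- The logarithm of a positive semidefinite operator, taken on its support
(functional calculus, with `Real.log 0 = 0` on the kernel). -/
def opLog (A : Matrix X X ℂ) : Matrix X X ℂ :=
  cfc Real.log A

/-- The von Neumann entropy `S(ρ) = -Tr (ρ log ρ)`. -/
def vonNeumannEntropy (ρ : Matrix X X ℂ) : ℝ :=
  -(ρ * opLog ρ).trace.re

open Classical in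
/-- The quantum relative entropy `D(ρ‖σ) = Tr ρ (log ρ - log σ)` if the kernel of `σ` is contained
in the kernel of `ρ` (that is, `supp ρ ⊆ supp σ`), and `+∞` otherwise. -/
def relEntropy (ρ σ : Matrix X X ℂ) : EReal :=
  if ∀ v : X → ℂ, σ *ᵥ v = 0 → ρ *ᵥ v = 0 then
    (((ρ * (opLog ρ - opLog σ)).trace.re : ℝ) : EReal)
  else ⊤

/-- The minimal observational entropy `S_χ(ρ)` over a set `χ` of POVMs. -/
def minObsEntropy (χ : Set (POVM X)) (ρ : Matrix X X ℂ) : EReal :=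
  ⨅ M ∈ χ, ((M.obsEntropy ρ : ℝ) : EReal)

/-- The entropy gap `E_χ(ρ) = S_χ(ρ) - S(ρ)`. -/
def gap (χ : Set (POVM X)) (ρ : Matrix X X ℂ) : EReal :=
  minObsEntropy χ ρ - ((vonNeumannEntropy ρ : ℝ) : EReal)

/-- The relative entropy distance `inf_{σ ∈ Ω} D(ρ‖σ)` to a set `Ω` of states. -/
def relEntropyDist (Ω : Set (Matrix X X ℂ)) (ρ : Matrix X X ℂ) : EReal :=
  ⨅ σ ∈ Ω, relEntropy ρ σ

end General

/-! ### Multipartite systems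

The `k`-th subsystem is `ℂ^(d k)`; the joint system is their tensor product. -/

section Multipartite

variable {n : ℕ}

/-- The index set of the product basis of `ℂ^(d 0) ⊗ ⋯ ⊗ ℂ^(d (n-1))`. -/
abbrev Idx (d : Fin n → ℕ) : Type := (k : Fin n) → Fin (d k)

variable {d : Fin n → ℕ}

/-- The product vector `ψ_1 ⊗ ⋯ ⊗ ψ_n`. -/
def tensorKet (ψ : (k : Fin n) → EuclideanSpace ℂ (Fin (d k))) : Idx d → ℂ :=
  fun x => ∏ k, ψ k (x k)

/-- The tensor product `A_1 ⊗ ⋯ ⊗ A_n` of operators on the subsystems. -/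
def tensorOp (A : (k : Fin n) → Matrix (Fin (d k)) (Fin (d k)) ℂ) : Matrix (Idx d) (Idx d) ℂ :=
  Matrix.of fun x y => ∏ k, A k (x k) (y k)

theorem tensorOp_mul (A B : (k : Fin n) → Matrix (Fin (d k)) (Fin (d k)) ℂ) :
    tensorOp A * tensorOp B = tensorOp fun k => A k * B k := by
  ext x y
  simp only [tensorOp, Matrix.mul_apply, Matrix.of_apply]
  rw [Finset.prod_univ_sum, Fintype.piFinset_univ]
  exact Finset.sum_congr rfl fun z _ => Finset.prod_mul_distrib.symm

theorem tensorOp_conjTranspose (A : (k : Fin n) → Matrix (Fin (d k)) (Fin (d k)) ℂ) :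
    (tensorOp A)ᴴ = tensorOp fun k => (A k)ᴴ := by
  ext x y
  simp [tensorOp, Matrix.conjTranspose_apply]

theorem tensorOp_one :
    tensorOp (fun k => (1 : Matrix (Fin (d k)) (Fin (d k)) ℂ)) = 1 := by
  ext x y
  simp only [tensorOp, Matrix.of_apply, Matrix.one_apply]
  by_cases h : x = y
  · subst h
    simp
  · obtain ⟨k, hk⟩ := Function.ne_iff.mp h
    rw [if_neg h]
    exact Finset.prod_eq_zero (Finset.mem_univ k) (if_neg hk)

open scoped MatrixOrder Matrix.Norms.L2Operator in
theorem tensorOp_posSemidef {A : (k : Fin n) → Matrix (Fin (d k)) (Fin (d k)) ℂ}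
    (hA : ∀ k, (A k).PosSemidef) : (tensorOp A).PosSemidef := by
  have h : ∀ k, ∃ B : Matrix (Fin (d k)) (Fin (d k)) ℂ, A k = Bᴴ * B := fun k =>
    CStarAlgebra.nonneg_iff_eq_star_mul_self.mp (hA k).nonneg
  choose B hB using h
  have : tensorOp A = (tensorOp B)ᴴ * tensorOp B := by
    rw [tensorOp_conjTranspose, tensorOp_mul]
    exact congrArg tensorOp (funext hB)
  rw [this]
  exact Matrix.posSemidef_conjTranspose_mul_self _

/-- The tensor product measurement `M_1 ⊗ ⋯ ⊗ M_n`. -/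
def tensorPOVM (M : (k : Fin n) → POVM (Fin (d k))) : POVM (Idx d) where
  Outcome := (k : Fin n) → (M k).Outcome
  fintypeOutcome := by classical exact inferInstance
  op i := tensorOp fun k => (M k).op (i k)
  posSemidef i := tensorOp_posSemidef fun k => (M k).posSemidef (i k)
  sum_op := by
    classical
    rw [← tensorOp_one]
    ext x y
    simp only [Matrix.sum_apply, tensorOp, Matrix.of_apply]
    have h : ∀ k, (1 : Matrix (Fin (d k)) (Fin (d k)) ℂ) (x k) (y k)
        = ∑ i, (M k).op i (x k) (y k) := fun k => by
      rw [← (M k).sum_op, Matrix.sum_apply]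
    simp only [h]
    rw [Finset.prod_univ_sum, Fintype.piFinset_univ]

/-- The partial transpose on the subsystems in `S`. -/
def partialTranspose (S : Finset (Fin n)) (A : Matrix (Idx d) (Idx d) ℂ) :
    Matrix (Idx d) (Idx d) ℂ :=
  Matrix.of fun x y => A (S.piecewise y x) (S.piecewise x y)

/-- Finite sums of tensor products of positive semidefinite operators. -/
def IsSeparableOp (A : Matrix (Idx d) (Idx d) ℂ) : Prop :=
  ∃ (m : ℕ) (B : Fin m → (k : Fin n) → Matrix (Fin (d k)) (Fin (d k)) ℂ),
    (∀ j k, (B j k).PosSemidef) ∧ A = ∑ j, tensorOp (B j)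

/-- Operators whose partial transpose is positive for every bipartition of the parties
(`S = ∅` gives positivity of the operator itself). -/
def IsPPTOp (A : Matrix (Idx d) (Idx d) ℂ) : Prop :=
  ∀ S : Finset (Fin n), (partialTranspose S A).PosSemidef

variable (d)

/-- Local projective measurements. -/
def LOstar : Set (POVM (Idx d)) :=
  {M | ∃ P : (k : Fin n) → POVM (Fin (d k)), (∀ k, (P k).IsProjective) ∧ M = tensorPOVM P}

/-- Separable measurements. -/
def SEP : Set (POVM (Idx d)) :=
  {M | ∀ i, IsSeparableOp (M.op i)}

/-- Measurements with positive partial transpose. -/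
def PPT : Set (POVM (Idx d)) :=
  {M | ∀ i, IsPPTOp (M.op i)}

/-- Classically correlated states: diagonal in a product of local orthonormal bases. -/
def ccStates : Set (Matrix (Idx d) (Idx d) ℂ) :=
  {σ | ∃ (ψ : (k : Fin n) → OrthonormalBasis (Fin (d k)) ℂ (EuclideanSpace ℂ (Fin (d k))))
      (p : Idx d → ℝ), (∀ i, 0 ≤ p i) ∧ ∑ i, p i = 1 ∧
      σ = ∑ i, (p i : ℂ) • ketbra (tensorKet fun k => ψ k (i k))}

/-- Separable states: finite convex combinations of product states. -/
def sepStates : Set (Matrix (Idx d) (Idx d) ℂ) :=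
  {σ | ∃ (m : ℕ) (p : Fin m → ℝ) (τ : Fin m → (k : Fin n) → Matrix (Fin (d k)) (Fin (d k)) ℂ),
      (∀ j, 0 ≤ p j) ∧ ∑ j, p j = 1 ∧ (∀ j k, IsState (τ j k)) ∧
      σ = ∑ j, (p j : ℂ) • tensorOp (τ j)}

/-- States with positive partial transpose. -/
def pptStates : Set (Matrix (Idx d) (Idx d) ℂ) :=
  {σ | IsState σ ∧ IsPPTOp σ}

variable {d}

/-- The relative entropy of quantumness. -/
def relEntQuantumness (ρ : Matrix (Idx d) (Idx d) ℂ) : EReal :=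
  relEntropyDist (ccStates d) ρ

/-- The relative entropy of entanglement. -/
def relEntEntanglement (ρ : Matrix (Idx d) (Idx d) ℂ) : EReal :=
  relEntropyDist (sepStates d) ρ

/-- The PPT relative entropy of entanglement. -/
def relEntEntanglementPPT (ρ : Matrix (Idx d) (Idx d) ℂ) : EReal :=
  relEntropyDist (pptStates d) ρ

end Multipartite

end EntropyGap

end

/-!
The coarse-grained state `σ = ∑ i, (p i / V i) • M i` of a measurement `M` satisfies
`D(ρ‖σ) ≤ S_M(ρ) - S(ρ)`, that is, `∑ i, p i * log (p i / V i) ≤ Tr (ρ log σ)`. This is the operator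
Jensen inequality for the logarithm. It follows from the one for the inverse,
`(∑ i, b i • M i)⁻¹ ≤ ∑ i, (b i)⁻¹ • M i`, which is seen by completing a square: apply it to
`b i = p i / V i + t` and integrate the resolvents over `t > 0`. Since `σ` is a nonnegative
combination of the elements of `M`, it inherits their separability or positive partial transpose,
and for a local projective measurement it is diagonal in a product basis.

Conversely, a classically correlated `σ` is diagonal in a product basis, and for the measurement in
that basis Gibbs' inequality gives `S_M(ρ) - S(ρ) ≤ D(ρ‖σ)`.
-/

namespace EntropyGap

open Matrix
open scoped ComplexOrder

section TraceOfProduct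

variable {𝕜 X : Type*} [RCLike 𝕜] [Fintype X] {A B : Matrix X X 𝕜}

theorem trace_conjTranspose_mul_self_mul (C D : Matrix X X 𝕜) :
    (Cᴴ * C * (Dᴴ * D)).trace = (C * Dᴴ * (C * Dᴴ)ᴴ).trace := by
  rw [conjTranspose_mul, conjTranspose_conjTranspose, trace_mul_comm, trace_mul_comm (C * Dᴴ)]
  simp only [Matrix.mul_assoc]
  rw [trace_mul_comm]
  simp only [Matrix.mul_assoc]

open scoped MatrixOrder in
theorem trace_mul_nonneg (hA : A.PosSemidef) (hB : B.PosSemidef) : 0 ≤ (A * B).trace := by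
  classical
  obtain ⟨C, rfl⟩ := CStarAlgebra.nonneg_iff_eq_star_mul_self.mp hA.nonneg
  obtain ⟨D, rfl⟩ := CStarAlgebra.nonneg_iff_eq_star_mul_self.mp hB.nonneg
  simp only [star_eq_conjTranspose, trace_conjTranspose_mul_self_mul]
  exact (posSemidef_self_mul_conjTranspose _).trace_nonneg

open scoped MatrixOrder in
theorem mul_eq_zero_of_trace_mul_eq_zero (hA : A.PosSemidef) (hB : B.PosSemidef)
    (h : (A * B).trace = 0) : A * B = 0 := by
  classical
  obtain ⟨C, rfl⟩ := CStarAlgebra.nonneg_iff_eq_star_mul_self.mp hA.nonneg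
  obtain ⟨D, rfl⟩ := CStarAlgebra.nonneg_iff_eq_star_mul_self.mp hB.nonneg
  simp only [star_eq_conjTranspose] at h ⊢
  rw [trace_conjTranspose_mul_self_mul, trace_mul_conjTranspose_self_eq_zero_iff] at h
  rw [Matrix.mul_assoc, ← Matrix.mul_assoc C, h, Matrix.zero_mul, Matrix.mul_zero]

theorem mul_eq_zero_of_ker_le {Y R : Type*} [Semiring R] {A B : Matrix X X R}
    (hker : ∀ v, A *ᵥ v = 0 → B *ᵥ v = 0) {C : Matrix X Y R} (h : A * C = 0) : B * C = 0 := by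
  have hcol (j : Y) : B *ᵥ C.col j = 0 :=
    hker _ <| funext fun i => congrFun (congrFun h i) j
  exact Matrix.ext fun i j => congrFun (hcol j) i

end TraceOfProduct

section FunctionalCalculus

open Polynomial in
theorem cfc_algHom_pi {ι A : Type*} [Finite ι] [Ring A] [StarRing A] [TopologicalSpace A]
    [Algebra ℝ A] [ContinuousFunctionalCalculus ℝ A IsSelfAdjoint] (φ : (ι → ℝ) →ₐ[ℝ] A)
    (f : ℝ → ℝ) {c : ι → ℝ} (hc : IsSelfAdjoint (φ c)) : cfc f (φ c) = φ (f ∘ c) := by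
  classical
  -- On the finite spectrum of `φ c`, the function `f` agrees with an interpolating polynomial.
  have hfin : (Set.range c).Finite := Set.finite_range c
  let q : ℝ[X] := Lagrange.interpolate hfin.toFinset id f
  have hq (i : ι) : q.eval (c i) = f (c i) :=
    Lagrange.eval_interpolate_at_node f (Set.injOn_id _) (hfin.mem_toFinset.mpr ⟨i, rfl⟩)
  have hspec : spectrum ℝ (φ c) ⊆ Set.range c := by
    refine (AlgHom.spectrum_apply_subset φ c).trans ?_
    rw [Pi.spectrum_eq]
    refine Set.iUnion_subset fun i => ?_
    rw [← Algebra.algebraMap_self_apply (c i), spectrum.scalar_eq, Set.singleton_subset_iff]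
    exact Set.mem_range_self i
  calc cfc f (φ c) = cfc q.eval (φ c) := cfc_congr fun x hx => by
        obtain ⟨i, rfl⟩ := hspec hx
        exact (hq i).symm
    _ = aeval (φ c) q := cfc_polynomial q (φ c)
    _ = φ (aeval c q) := aeval_algHom_apply φ c q
    _ = φ (f ∘ c) := congrArg φ (funext fun i => by simp [aeval_fn_apply, hq])

end FunctionalCalculus

section LogarithmicSums

open Filter Topology

variable {ι κ : Type*} [Fintype ι] [Fintype κ] {w c : ι → ℝ} {a l : κ → ℝ}

/-- The logarithmic potential of the finite signed measure `∑ i, w i • δ (c i)` at the point `-t`.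
Its derivative in `t` is the resolvent sum `∑ i, w i * (c i + t)⁻¹`, so that inequalities between
resolvents can be integrated to inequalities between logarithms. -/
noncomputable def logPotential (w c : ι → ℝ) (t : ℝ) : ℝ :=
  ∑ i, w i * Real.log (c i + t)

theorem hasDerivAt_logPotential (hc : ∀ i, 0 ≤ c i) {t : ℝ} (ht : 0 < t) :
    HasDerivAt (logPotential w c) (∑ i, w i * (c i + t)⁻¹) t := by
  refine HasDerivAt.fun_sum fun i _ => HasDerivAt.const_mul _ ?_
  simpa using ((hasDerivAt_id t).const_add (c i)).log (add_pos_of_nonneg_of_pos (hc i) ht).ne'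

theorem tendsto_logPotential_sub_mul_log_atTop (w c : ι → ℝ) :
    Tendsto (fun t => logPotential w c t - (∑ i, w i) * Real.log t) atTop (𝓝 0) := by
  have hterm (i : ι) : Tendsto (fun t => w i * (Real.log (t + c i) - Real.log t)) atTop (𝓝 0) := by
    simpa using (Real.tendsto_log_comp_add_sub_log (c i)).const_mul (w i)
  refine (by simpa using tendsto_finsetSum Finset.univ fun i _ => hterm i :
    Tendsto _ atTop (𝓝 (0 : ℝ))).congr fun t => ?_
  simp only [logPotential, mul_sub, Finset.sum_sub_distrib, Finset.sum_mul, add_comm t]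

theorem tendsto_logPotential_nhds_zero (h0 : ∀ i, c i = 0 → w i = 0) :
    Tendsto (logPotential w c) (𝓝 0) (𝓝 (∑ i, w i * Real.log (c i))) := by
  refine tendsto_finsetSum _ fun i _ => ?_
  by_cases hi : c i = 0
  · simp [h0 i hi]
  · have hadd : Tendsto (fun t => c i + t) (𝓝 0) (𝓝 (c i)) := by
      simpa using (continuous_const_add (c i)).tendsto 0
    exact (hadd.log hi).const_mul (w i)

theorem sum_mul_log_le_of_resolvent_le (hc : ∀ i, 0 ≤ c i) (hl : ∀ k, 0 ≤ l k)
    (hc0 : ∀ i, c i = 0 → w i = 0) (hl0 : ∀ k, l k = 0 → a k = 0) (hsum : ∑ k, a k = ∑ i, w i)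
    (h : ∀ t > 0, ∑ k, a k * (l k + t)⁻¹ ≤ ∑ i, w i * (c i + t)⁻¹) :
    ∑ i, w i * Real.log (c i) ≤ ∑ k, a k * Real.log (l k) := by
  let F : ℝ → ℝ := fun t => logPotential w c t - logPotential a l t
  have hderiv (t : ℝ) (ht : 0 < t) :
      HasDerivAt F (∑ i, w i * (c i + t)⁻¹ - ∑ k, a k * (l k + t)⁻¹) t :=
    (hasDerivAt_logPotential hc ht).sub (hasDerivAt_logPotential hl ht)
  have hmono : MonotoneOn F (Set.Ioi 0) := by
    refine monotoneOn_of_deriv_nonneg (convex_Ioi 0)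
      (fun t ht => (hderiv t ht).continuousAt.continuousWithinAt) ?_ ?_ <;> rw [interior_Ioi]
    · exact fun t ht => (hderiv t ht).differentiableAt.differentiableWithinAt
    · exact fun t ht => (hderiv t ht).deriv ▸ sub_nonneg.mpr (h t ht)
  have hatTop : Tendsto F atTop (𝓝 0) := by
    simpa [F, hsum] using (tendsto_logPotential_sub_mul_log_atTop w c).sub
      (tendsto_logPotential_sub_mul_log_atTop a l)
  have hzero : Tendsto F (𝓝[>] 0)
      (𝓝 (∑ i, w i * Real.log (c i) - ∑ k, a k * Real.log (l k))) :=
    ((tendsto_logPotential_nhds_zero hc0).sub (tendsto_logPotential_nhds_zero hl0)).mono_left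
      nhdsWithin_le_nhds
  have hnonpos (t : ℝ) (ht : 0 < t) : F t ≤ 0 :=
    ge_of_tendsto hatTop <| (eventually_ge_atTop t).mono fun s hs => hmono ht (ht.trans_le hs) hs
  exact sub_nonpos.mp (le_of_tendsto hzero (eventually_nhdsWithin_of_forall hnonpos))

theorem sum_mul_log_le_sum_mul_log_div {q V : ι → ℝ} (hq : ∀ i, 0 ≤ q i) (hV : ∀ i, 0 ≤ V i)
    (hc : ∀ i, 0 ≤ c i) (hV0 : ∀ i, V i = 0 → q i = 0) (hc0 : ∀ i, c i = 0 → q i = 0)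
    (hsum : ∑ i, c i * V i ≤ ∑ i, q i) :
    ∑ i, q i * Real.log (c i) ≤ ∑ i, q i * Real.log (q i / V i) := by
  have hterm (i : ι) : q i * Real.log (c i) - q i * Real.log (q i / V i) ≤ c i * V i - q i := by
    rcases (hq i).eq_or_lt with hqi | hqi
    · simpa [← hqi] using mul_nonneg (hc i) (hV i)
    have hVi : 0 < V i := (hV i).lt_of_ne' fun h => hqi.ne' (hV0 i h)
    have hci : 0 < c i := (hc i).lt_of_ne' fun h => hqi.ne' (hc0 i h)
    calc q i * Real.log (c i) - q i * Real.log (q i / V i)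
        = q i * Real.log (c i / (q i / V i)) := by
          rw [Real.log_div hci.ne' (div_pos hqi hVi).ne', mul_sub]
      _ ≤ q i * (c i / (q i / V i) - 1) := by
          gcongr
          exact Real.log_le_sub_one_of_pos (by positivity)
      _ = c i * V i - q i := by field_simp
  have := Finset.sum_le_sum fun i (_ : i ∈ Finset.univ) => hterm i
  rw [Finset.sum_sub_distrib, Finset.sum_sub_distrib] at this
  linarith

end LogarithmicSums

section Ketbra

variable {X : Type} [Fintype X] (ψ : OrthonormalBasis X ℂ (EuclideanSpace ℂ X))

theorem star_dotProduct_orthonormalBasis [DecidableEq X] (i j : X) :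
    star (ψ i : X → ℂ) ⬝ᵥ ψ j = if i = j then 1 else 0 := by
  rw [dotProduct_comm, ← EuclideanSpace.inner_eq_star_dotProduct,
    orthonormal_iff_ite.mp ψ.orthonormal]

theorem ketbra_mul_ketbra_orthonormalBasis [DecidableEq X] (i j : X) :
    ketbra (ψ i) * ketbra (ψ j) = if i = j then ketbra (ψ i) else 0 := by
  rw [ketbra, ketbra, vecMulVec_mul_vecMulVec, star_dotProduct_orthonormalBasis]
  split_ifs with h <;> simp [h]

theorem trace_ketbra_orthonormalBasis (i : X) : (ketbra (ψ i)).trace = 1 := by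
  classical
  rw [ketbra, trace_vecMulVec, dotProduct_comm, star_dotProduct_orthonormalBasis, if_pos rfl]

end Ketbra

namespace POVM

variable {X : Type} [Fintype X] [DecidableEq X] (M : POVM X) {ρ : Matrix X X ℂ}

/-- The integral `∑ i, c i • M.op i` of a real function `c` on the outcomes against the
operator-valued measure `M`. Operators of interest are written as such integrals: coarse-grained
states, and, for the measurement in an eigenbasis, arbitrary Hermitian operators. -/
noncomputable def integral : (M.Outcome → ℝ) →ₗ[ℝ] Matrix X X ℂ :=
  Fintype.linearCombination ℝ M.op

theorem integral_apply (c : M.Outcome → ℝ) : M.integral c = ∑ i, c i • M.op i :=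
  rfl

theorem integral_one : M.integral 1 = 1 := by
  simp [integral_apply, M.sum_op]

theorem integral_single [DecidableEq M.Outcome] (i : M.Outcome) :
    M.integral (Pi.single i 1) = M.op i := by
  rw [integral, Fintype.linearCombination_apply_single, one_smul]

theorem integral_add_const (c : M.Outcome → ℝ) (t : ℝ) :
    M.integral (fun i => c i + t) = M.integral c + t • 1 := by
  rw [← integral_one, ← map_smul, ← map_add]
  congr 1
  ext i
  simp

theorem isHermitian_integral (c : M.Outcome → ℝ) : (M.integral c).IsHermitian :=
  isSelfAdjoint_sum _ fun i _ => (IsSelfAdjoint.all (c i)).smul (M.posSemidef i).isHermitian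

theorem posSemidef_integral {c : M.Outcome → ℝ} (hc : ∀ i, 0 ≤ c i) :
    (M.integral c).PosSemidef :=
  posSemidef_sum _ fun i _ => (M.posSemidef i).smul (hc i)

theorem re_trace_mul_integral (ρ : Matrix X X ℂ) (c : M.Outcome → ℝ) :
    (ρ * M.integral c).trace.re = ∑ i, M.prob ρ i * c i := by
  simp [integral_apply, Matrix.mul_sum, prob, mul_comm]

theorem ofReal_volume (i : M.Outcome) : (M.volume i : ℂ) = (M.op i).trace :=
  (Complex.eq_re_of_ofReal_le (M.posSemidef i).trace_nonneg).symm

theorem ofReal_prob (hρ : ρ.PosSemidef) (i : M.Outcome) :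
    (M.prob ρ i : ℂ) = (ρ * M.op i).trace :=
  (Complex.eq_re_of_ofReal_le (trace_mul_nonneg hρ (M.posSemidef i))).symm

theorem trace_integral (c : M.Outcome → ℝ) :
    (M.integral c).trace = (∑ i, c i * M.volume i : ℝ) := by
  simp [integral_apply, trace_sum, ofReal_volume]

theorem volume_nonneg (i : M.Outcome) : 0 ≤ M.volume i :=
  (Complex.le_def.mp (M.posSemidef i).trace_nonneg).1

theorem prob_nonneg (hρ : ρ.PosSemidef) (i : M.Outcome) : 0 ≤ M.prob ρ i :=
  (Complex.le_def.mp (trace_mul_nonneg hρ (M.posSemidef i))).1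

theorem sum_prob (ρ : Matrix X X ℂ) : ∑ i, M.prob ρ i = ρ.trace.re := by
  simpa [integral_one] using (M.re_trace_mul_integral ρ 1).symm

theorem prob_eq_zero_of_volume_eq_zero (ρ : Matrix X X ℂ) {i : M.Outcome} (h : M.volume i = 0) :
    M.prob ρ i = 0 := by
  have hop : M.op i = 0 := by
    rw [← (M.posSemidef i).trace_eq_zero_iff, ← ofReal_volume, h, Complex.ofReal_zero]
  simp [prob, hop]

theorem mul_op_eq_zero_of_prob_eq_zero (hρ : ρ.PosSemidef) {i : M.Outcome}
    (h : M.prob ρ i = 0) : ρ * M.op i = 0 :=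
  mul_eq_zero_of_trace_mul_eq_zero hρ (M.posSemidef i) <| by
    rw [← M.ofReal_prob hρ, h, Complex.ofReal_zero]

theorem op_mulVec_eq_zero_of_integral_mulVec_eq_zero {c : M.Outcome → ℝ} (hc : ∀ i, 0 ≤ c i)
    {v : X → ℂ} (hv : M.integral c *ᵥ v = 0) {i : M.Outcome} (hi : c i ≠ 0) :
    M.op i *ᵥ v = 0 := by
  have hpos (j : M.Outcome) : (c j • M.op j).PosSemidef := (M.posSemidef j).smul (hc j)
  have hsum : ∑ j, star v ⬝ᵥ (c j • M.op j) *ᵥ v = 0 := by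
    rw [← dotProduct_sum, ← sum_mulVec, ← integral_apply, hv, dotProduct_zero]
  have hterm := (Finset.sum_eq_zero_iff_of_nonneg
    fun j _ => (hpos j).dotProduct_mulVec_nonneg v).mp hsum i (Finset.mem_univ i)
  rw [(hpos i).dotProduct_mulVec_zero_iff, smul_mulVec] at hterm
  exact (smul_eq_zero.mp hterm).resolve_left hi

theorem mulVec_eq_zero_of_integral_mulVec_eq_zero (hρ : ρ.PosSemidef) {c : M.Outcome → ℝ}
    (hc : ∀ i, 0 ≤ c i) (hc0 : ∀ i, c i = 0 → M.prob ρ i = 0) {v : X → ℂ}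
    (hv : M.integral c *ᵥ v = 0) : ρ *ᵥ v = 0 := by
  have hop (i : M.Outcome) : ρ *ᵥ (M.op i *ᵥ v) = 0 := by
    by_cases hi : c i = 0
    · rw [mulVec_mulVec, M.mul_op_eq_zero_of_prob_eq_zero hρ (hc0 i hi), zero_mulVec]
    · rw [M.op_mulVec_eq_zero_of_integral_mulVec_eq_zero hc hv hi, mulVec_zero]
  calc ρ *ᵥ v = ρ *ᵥ ((∑ i, M.op i) *ᵥ v) := by rw [M.sum_op, one_mulVec]
    _ = ∑ i, ρ *ᵥ (M.op i *ᵥ v) := by rw [sum_mulVec, mulVec_sum]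
    _ = 0 := Finset.sum_eq_zero fun i _ => hop i

theorem posSemidef_integral_inv_sub {b : M.Outcome → ℝ} (hb : ∀ i, 0 < b i) {R : Matrix X X ℂ}
    (hR : R.IsHermitian) (h : M.integral b * R = 1) : (M.integral b⁻¹ - R).PosSemidef := by
  have hsquare (i : M.Outcome) :
      (b i)⁻¹ • ((1 - b i • R)ᴴ * M.op i * (1 - b i • R))
        = (b i)⁻¹ • M.op i - M.op i * R - R * M.op i + R * (b i • M.op i) * R := by
    have hR' : (1 - b i • R)ᴴ = 1 - b i • R := by simp [hR.eq]
    simp only [hR', sub_mul, mul_sub, Matrix.one_mul, Matrix.mul_one, Matrix.smul_mul,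
      Matrix.mul_smul, smul_sub, inv_smul_smul₀ (hb i).ne']
    abel
  have hsum : M.integral b⁻¹ - R
      = ∑ i, (b i)⁻¹ • ((1 - b i • R)ᴴ * M.op i * (1 - b i • R)) := by
    simp only [hsquare]
    rw [Finset.sum_add_distrib, Finset.sum_sub_distrib, Finset.sum_sub_distrib, ← Matrix.sum_mul,
      ← Matrix.mul_sum, ← Matrix.sum_mul, ← Matrix.mul_sum, M.sum_op,
      ← M.integral_apply b, Matrix.mul_assoc, h]
    simp [integral_apply]
  rw [hsum]
  exact posSemidef_sum _ fun i _ =>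
    ((M.posSemidef i).conjTranspose_mul_mul_same _).smul (inv_nonneg.mpr (hb i).le)

/-- The coarse-grained state `∑ i, (p i / V i) • M.op i`, which retains of `ρ` only the outcome
probabilities `p i`. An outcome of volume `V i = 0` has `M.op i = 0` and does not contribute. -/
noncomputable def coarse (ρ : Matrix X X ℂ) : Matrix X X ℂ :=
  M.integral fun i => M.prob ρ i / M.volume i

theorem prob_div_volume_nonneg (hρ : ρ.PosSemidef) (i : M.Outcome) :
    0 ≤ M.prob ρ i / M.volume i :=
  div_nonneg (M.prob_nonneg hρ i) (M.volume_nonneg i)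

theorem prob_eq_zero_of_prob_div_volume_eq_zero {i : M.Outcome}
    (h : M.prob ρ i / M.volume i = 0) : M.prob ρ i = 0 :=
  (div_eq_zero_iff.mp h).elim id (M.prob_eq_zero_of_volume_eq_zero ρ)

theorem isState_coarse (hρ : IsState ρ) : IsState (M.coarse ρ) := by
  refine ⟨M.posSemidef_integral (M.prob_div_volume_nonneg hρ.1), ?_⟩
  have hterm (i : M.Outcome) : M.prob ρ i / M.volume i * M.volume i = M.prob ρ i :=
    div_mul_cancel_of_imp (M.prob_eq_zero_of_volume_eq_zero ρ)
  simp only [coarse, trace_integral, hterm, sum_prob, hρ.2, Complex.one_re, Complex.ofReal_one]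

/-- The projective measurement in an orthonormal basis. -/
noncomputable def ofBasis (ψ : OrthonormalBasis X ℂ (EuclideanSpace ℂ X)) : POVM X where
  Outcome := X
  op i := ketbra (ψ i)
  posSemidef i := posSemidef_vecMulVec_self_star _
  sum_op := by
    ext x y
    have hrepr := congrArg (fun v : EuclideanSpace ℂ X => v x)
      (ψ.sum_repr' (EuclideanSpace.single y 1))
    simpa [ketbra, vecMulVec_apply, Matrix.sum_apply, one_apply, mul_comm, Pi.single_apply,
      EuclideanSpace.inner_single_right]
      using hrepr

end POVM

section Projective

namespace POVM

variable {X : Type} [Fintype X] [DecidableEq X] {M : POVM X} {ρ : Matrix X X ℂ}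

theorem IsProjective.op_mul_op [DecidableEq M.Outcome] (hM : M.IsProjective) (i j : M.Outcome) :
    M.op i * M.op j = if i = j then M.op i else 0 := by
  split_ifs with h
  · rw [← h, hM.1]
  · exact hM.2 i j h

theorem IsProjective.integral_mul_op (hM : M.IsProjective) (c : M.Outcome → ℝ) (i : M.Outcome) :
    M.integral c * M.op i = c i • M.op i := by
  classical
  simp [integral_apply, Matrix.sum_mul, hM.op_mul_op]

theorem IsProjective.integral_mul_integral (hM : M.IsProjective) (b c : M.Outcome → ℝ) :
    M.integral b * M.integral c = M.integral (b * c) := by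
  simp only [integral_apply M c, Matrix.mul_sum, Matrix.mul_smul, hM.integral_mul_op, smul_smul]
  simp [integral_apply, mul_comm]

theorem IsProjective.cfc_integral (hM : M.IsProjective) (f : ℝ → ℝ) (c : M.Outcome → ℝ) :
    cfc f (M.integral c) = M.integral (f ∘ c) :=
  let φ : (M.Outcome → ℝ) →ₐ[ℝ] Matrix X X ℂ :=
    .ofLinearMap M.integral M.integral_one fun b c => (hM.integral_mul_integral b c).symm
  cfc_algHom_pi φ f (M.isHermitian_integral c)

theorem IsProjective.re_trace_mul_opLog_integral (hM : M.IsProjective) (ρ : Matrix X X ℂ)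
    (c : M.Outcome → ℝ) :
    (ρ * opLog (M.integral c)).trace.re = ∑ i, M.prob ρ i * Real.log (c i) := by
  rw [opLog, hM.cfc_integral, re_trace_mul_integral]
  rfl

theorem IsProjective.prob_eq_zero_of_ker_le (hM : M.IsProjective) {c : M.Outcome → ℝ}
    (hker : ∀ v, M.integral c *ᵥ v = 0 → ρ *ᵥ v = 0) {i : M.Outcome} (hi : c i = 0) :
    M.prob ρ i = 0 := by
  have hop : M.integral c * M.op i = 0 := by rw [hM.integral_mul_op, hi, zero_smul]
  simp [prob, mul_eq_zero_of_ker_le hker hop]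

theorem isProjective_ofBasis (ψ : OrthonormalBasis X ℂ (EuclideanSpace ℂ X)) :
    (ofBasis ψ).IsProjective :=
  ⟨fun i => (ketbra_mul_ketbra_orthonormalBasis ψ i i).trans (if_pos rfl),
    fun i j hij => (ketbra_mul_ketbra_orthonormalBasis ψ i j).trans (if_neg hij)⟩

theorem integral_eigenvalues {A : Matrix X X ℂ} (hA : A.IsHermitian) :
    (ofBasis hA.eigenvectorBasis).integral hA.eigenvalues = A := by
  have hop (i : X) : A * (ofBasis hA.eigenvectorBasis).op i
      = hA.eigenvalues i • (ofBasis hA.eigenvectorBasis).op i := by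
    simp only [ofBasis, ketbra, mul_vecMulVec, hA.mulVec_eigenvectorBasis, smul_vecMulVec]
  calc (ofBasis hA.eigenvectorBasis).integral hA.eigenvalues
      = A * ∑ i, (ofBasis hA.eigenvectorBasis).op i := by
        rw [Matrix.mul_sum]
        exact Finset.sum_congr rfl fun i _ => (hop i).symm
    _ = A := by rw [sum_op, Matrix.mul_one]

end POVM

end Projective

section EntropyBounds

variable {X : Type} [Fintype X] [DecidableEq X] {ρ : Matrix X X ℂ}

theorem re_trace_mul_opLog_sub_opLog (ρ σ : Matrix X X ℂ) :
    (ρ * (opLog ρ - opLog σ)).trace.re = -(ρ * opLog σ).trace.re - vonNeumannEntropy ρ := by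
  rw [Matrix.mul_sub, trace_sub, Complex.sub_re, vonNeumannEntropy]
  ring

namespace POVM

theorem IsProjective.sum_prob_mul_inv_le {N : POVM X} (hN : N.IsProjective) (M : POVM X)
    (hρ : ρ.PosSemidef) {b : M.Outcome → ℝ} {l : N.Outcome → ℝ} (hb : ∀ i, 0 < b i)
    (hl : ∀ k, 0 < l k) (h : N.integral l = M.integral b) :
    ∑ k, N.prob ρ k * (l k)⁻¹ ≤ ∑ i, M.prob ρ i * (b i)⁻¹ := by
  have hinv : M.integral b * N.integral l⁻¹ = 1 := by
    rw [← h, hN.integral_mul_integral, ← integral_one]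
    exact congrArg _ (funext fun k => mul_inv_cancel₀ (hl k).ne')
  have hpos := trace_mul_nonneg hρ
    (M.posSemidef_integral_inv_sub hb (N.isHermitian_integral _) hinv)
  have hre := (Complex.le_def.mp hpos).1
  rw [Matrix.mul_sub, trace_sub, Complex.sub_re, re_trace_mul_integral,
    re_trace_mul_integral] at hre
  exact sub_nonneg.mp hre

theorem sum_prob_mul_log_le_re_trace_mul_opLog_integral (M : POVM X) (hρ : ρ.PosSemidef)
    {c : M.Outcome → ℝ} (hc : ∀ i, 0 ≤ c i) (hc0 : ∀ i, c i = 0 → M.prob ρ i = 0) :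
    ∑ i, M.prob ρ i * Real.log (c i) ≤ (ρ * opLog (M.integral c)).trace.re := by
  have hA := M.posSemidef_integral hc
  let N : POVM X := ofBasis hA.isHermitian.eigenvectorBasis
  let l : N.Outcome → ℝ := hA.isHermitian.eigenvalues
  have hN : N.IsProjective := isProjective_ofBasis _
  have hl : ∀ k, 0 ≤ l k := hA.eigenvalues_nonneg
  have hNl : N.integral l = M.integral c := integral_eigenvalues hA.isHermitian
  rw [← hNl, hN.re_trace_mul_opLog_integral]
  refine sum_mul_log_le_of_resolvent_le hc hl hc0 ?_ (by rw [sum_prob, sum_prob]) fun t ht => ?_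
  · exact fun k => hN.prob_eq_zero_of_ker_le fun v hv =>
      M.mulVec_eq_zero_of_integral_mulVec_eq_zero hρ hc hc0 (hNl ▸ hv)
  · refine hN.sum_prob_mul_inv_le M hρ (fun i => add_pos_of_nonneg_of_pos (hc i) ht)
      (fun k => add_pos_of_nonneg_of_pos (hl k) ht) ?_
    rw [integral_add_const, integral_add_const, hNl]

theorem relEntropy_coarse_le (M : POVM X) (hρ : ρ.PosSemidef) :
    relEntropy ρ (M.coarse ρ) ≤ ((M.obsEntropy ρ - vonNeumannEntropy ρ : ℝ) : EReal) := by
  have hc := M.prob_div_volume_nonneg hρ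
  have hc0 (i : M.Outcome) := M.prob_eq_zero_of_prob_div_volume_eq_zero (ρ := ρ) (i := i)
  have hker (v : X → ℂ) (hv : M.coarse ρ *ᵥ v = 0) : ρ *ᵥ v = 0 :=
    M.mulVec_eq_zero_of_integral_mulVec_eq_zero hρ hc hc0 hv
  rw [relEntropy, if_pos hker, EReal.coe_le_coe_iff, re_trace_mul_opLog_sub_opLog]
  exact sub_le_sub_right
    (neg_le_neg (M.sum_prob_mul_log_le_re_trace_mul_opLog_integral hρ hc hc0)) _

theorem IsProjective.le_relEntropy_integral {M : POVM X} (hM : M.IsProjective) (hρ : IsState ρ)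
    {c : M.Outcome → ℝ} (hc : ∀ i, 0 ≤ c i) (hσ : (M.integral c).trace = 1) :
    ((M.obsEntropy ρ - vonNeumannEntropy ρ : ℝ) : EReal) ≤ relEntropy ρ (M.integral c) := by
  rw [relEntropy]
  split_ifs with hker
  · rw [EReal.coe_le_coe_iff, re_trace_mul_opLog_sub_opLog, hM.re_trace_mul_opLog_integral,
      obsEntropy]
    have hsum : ∑ i, c i * M.volume i = ∑ i, M.prob ρ i := by
      rw [sum_prob, hρ.2, ← hσ, trace_integral, Complex.ofReal_re]
    exact sub_le_sub_right (neg_le_neg <| sum_mul_log_le_sum_mul_log_div (M.prob_nonneg hρ.1)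
      M.volume_nonneg hc (fun i => M.prob_eq_zero_of_volume_eq_zero ρ)
      (fun i => hM.prob_eq_zero_of_ker_le hker) hsum.le) _
  · exact le_top

end POVM

theorem relEntropyDist_le_gap {χ : Set (POVM X)} {Ω : Set (Matrix X X ℂ)} (hρ : ρ.PosSemidef)
    (h : ∀ M ∈ χ, M.coarse ρ ∈ Ω) : relEntropyDist Ω ρ ≤ gap χ ρ := by
  rw [gap, EReal.le_sub_iff_add_le (Or.inl (EReal.coe_ne_bot _)) (Or.inl (EReal.coe_ne_top _))]
  refine le_iInf₂ fun M hM => ?_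
  calc relEntropyDist Ω ρ + (vonNeumannEntropy ρ : EReal)
      ≤ ((M.obsEntropy ρ - vonNeumannEntropy ρ : ℝ) : EReal) + (vonNeumannEntropy ρ : EReal) :=
        add_le_add_left ((iInf₂_le _ (h M hM)).trans (M.relEntropy_coarse_le hρ)) _
    _ = (M.obsEntropy ρ : EReal) := by rw [← EReal.coe_add, sub_add_cancel]

theorem gap_le_relEntropyDist {χ : Set (POVM X)} {Ω : Set (Matrix X X ℂ)}
    (h : ∀ σ ∈ Ω, ∃ M ∈ χ,
      ((M.obsEntropy ρ - vonNeumannEntropy ρ : ℝ) : EReal) ≤ relEntropy ρ σ) :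
    gap χ ρ ≤ relEntropyDist Ω ρ := by
  refine le_iInf₂ fun σ hσ => ?_
  obtain ⟨M, hM, hle⟩ := h σ hσ
  refine le_trans ?_ hle
  rw [EReal.coe_sub]
  exact EReal.sub_le_sub (iInf₂_le _ hM) le_rfl

end EntropyBounds

section Coarsening

namespace POVM

variable {X : Type} [Fintype X] [DecidableEq X] {M N : POVM X} {ρ : Matrix X X ℂ}

/-- `M` is a coarsening of `N` if it can be realised by measuring `N` and then processing the
outcome: `f i j` is the probability of reporting `i` upon observing `j`. The normalisation
`∑ i, f i j = 1` is not imposed. -/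
def IsCoarseningOf (M N : POVM X) : Prop :=
  ∃ f : M.Outcome → N.Outcome → ℝ, (∀ i j, 0 ≤ f i j) ∧ ∀ i, M.op i = N.integral (f i)

theorem IsCoarseningOf.exists_coarse_eq_integral (h : M.IsCoarseningOf N) (hρ : ρ.PosSemidef) :
    ∃ p : N.Outcome → ℝ, (∀ j, 0 ≤ p j) ∧ M.coarse ρ = N.integral p := by
  obtain ⟨f, hf, hop⟩ := h
  refine ⟨∑ i, (M.prob ρ i / M.volume i) • f i, fun j => ?_, ?_⟩
  · simp only [Finset.sum_apply, Pi.smul_apply, smul_eq_mul]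
    exact Finset.sum_nonneg fun i _ => mul_nonneg (M.prob_div_volume_nonneg hρ i) (hf i j)
  · simp only [coarse, M.integral_apply, hop, map_sum, map_smul]

theorem IsProjective.exists_isCoarseningOf_ofBasis (hM : M.IsProjective) :
    ∃ ψ : OrthonormalBasis X ℂ (EuclideanSpace ℂ X), M.IsCoarseningOf (ofBasis ψ) := by
  classical
  obtain ⟨label, hlabel⟩ := Countable.exists_injective_nat M.Outcome
  let g : M.Outcome → ℝ := fun i => label i
  have hg : Function.Injective g := Nat.cast_injective.comp hlabel
  -- The elements of `M` are the spectral projections of `∑ i, g i • M.op i`.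
  have hA : (M.integral g).IsHermitian := M.isHermitian_integral g
  let δ (i : M.Outcome) (t : ℝ) : ℝ := if t = g i then 1 else 0
  refine ⟨hA.eigenvectorBasis, fun i => δ i ∘ hA.eigenvalues, fun i x => ?_, fun i => ?_⟩
  · exact ite_nonneg zero_le_one le_rfl
  · have hδ : δ i ∘ g = Pi.single i 1 := by
      ext j
      simp [δ, Pi.single_apply, hg.eq_iff]
    calc M.op i = cfc (δ i) (M.integral g) := by
          rw [hM.cfc_integral, hδ, integral_single]
      _ = cfc (δ i) ((ofBasis hA.eigenvectorBasis).integral hA.eigenvalues) := by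
          rw [integral_eigenvalues]
      _ = (ofBasis hA.eigenvectorBasis).integral (δ i ∘ hA.eigenvalues) :=
          (isProjective_ofBasis _).cfc_integral _ _

end POVM

end Coarsening

section TensorProduct

variable {n : ℕ} {d : Fin n → ℕ}

theorem trace_tensorOp (A : (k : Fin n) → Matrix (Fin (d k)) (Fin (d k)) ℂ) :
    (tensorOp A).trace = ∏ k, (A k).trace := by
  simp only [trace, diag_apply, tensorOp, of_apply, Finset.prod_univ_sum, Fintype.piFinset_univ]

theorem tensorOp_smul (c : Fin n → ℝ) (A : (k : Fin n) → Matrix (Fin (d k)) (Fin (d k)) ℂ) :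
    tensorOp (fun k => c k • A k) = (∏ k, c k) • tensorOp A := by
  ext x y
  simp [tensorOp, Finset.prod_mul_distrib]

theorem tensorOp_eq_zero {A : (k : Fin n) → Matrix (Fin (d k)) (Fin (d k)) ℂ} {k : Fin n}
    (h : A k = 0) : tensorOp A = 0 := by
  ext x y
  exact Finset.prod_eq_zero (Finset.mem_univ k) (by simp [h])

theorem tensorOp_ketbra (ψ : (k : Fin n) → EuclideanSpace ℂ (Fin (d k))) :
    tensorOp (fun k => ketbra (ψ k)) = ketbra (tensorKet ψ) := by
  ext x y
  simp [tensorOp, ketbra, tensorKet, vecMulVec_apply, Finset.prod_mul_distrib]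

theorem tensorOp_integral (M : (k : Fin n) → POVM (Fin (d k)))
    (f : (k : Fin n) → (M k).Outcome → ℝ) :
    tensorOp (fun k => (M k).integral (f k))
      = (tensorPOVM M).integral fun i => ∏ k, f k (i k) := by
  ext x y
  simp only [tensorOp, POVM.integral_apply, of_apply, Matrix.sum_apply, Matrix.smul_apply,
    Finset.prod_univ_sum, Fintype.piFinset_univ]
  refine Finset.sum_congr rfl fun i _ => ?_
  simp [tensorPOVM, tensorOp, Finset.prod_mul_distrib]

theorem POVM.IsProjective.tensorPOVM {M : (k : Fin n) → POVM (Fin (d k))}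
    (hM : ∀ k, (M k).IsProjective) : (tensorPOVM M).IsProjective := by
  refine ⟨fun i => ?_, fun i j hij => ?_⟩
  · exact (tensorOp_mul _ _).trans (congrArg tensorOp (funext fun k => (hM k).1 (i k)))
  · obtain ⟨k, hk⟩ := Function.ne_iff.mp hij
    exact (tensorOp_mul _ _).trans (tensorOp_eq_zero ((hM k).2 _ _ hk))

theorem POVM.IsCoarseningOf.tensorPOVM {M N : (k : Fin n) → POVM (Fin (d k))}
    (h : ∀ k, (M k).IsCoarseningOf (N k)) : (tensorPOVM M).IsCoarseningOf (tensorPOVM N) := by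
  choose f hf hop using h
  refine ⟨fun i j => ∏ k, f k (i k) (j k), fun i j => Finset.prod_nonneg fun k _ => hf k _ _,
    fun i => ?_⟩
  exact (congrArg tensorOp (funext fun k => hop k (i k))).trans (tensorOp_integral _ _)

end TensorProduct

section ClassicallyCorrelated

variable {n : ℕ} {d : Fin n → ℕ} {ρ : Matrix (Idx d) (Idx d) ℂ}

theorem integral_tensorPOVM_ofBasis
    (ψ : (k : Fin n) → OrthonormalBasis (Fin (d k)) ℂ (EuclideanSpace ℂ (Fin (d k))))
    (p : Idx d → ℝ) :
    (tensorPOVM fun k => POVM.ofBasis (ψ k)).integral p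
      = ∑ i, (p i : ℂ) • ketbra (tensorKet fun k => ψ k (i k)) := by
  refine Finset.sum_congr rfl fun i _ => ?_
  rw [← tensorOp_ketbra, Complex.coe_smul]
  rfl

theorem trace_integral_tensorPOVM_ofBasis
    (ψ : (k : Fin n) → OrthonormalBasis (Fin (d k)) ℂ (EuclideanSpace ℂ (Fin (d k))))
    (p : Idx d → ℝ) :
    ((tensorPOVM fun k => POVM.ofBasis (ψ k)).integral p).trace = (∑ i, p i : ℝ) := by
  simp [integral_tensorPOVM_ofBasis, ← tensorOp_ketbra, trace_sum, trace_tensorOp,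
    trace_ketbra_orthonormalBasis]

theorem coarse_mem_ccStates (hρ : IsState ρ) {M : POVM (Idx d)} (hM : M ∈ LOstar d) :
    M.coarse ρ ∈ ccStates d := by
  obtain ⟨P, hP, rfl⟩ := hM
  choose ψ hψ using fun k => (hP k).exists_isCoarseningOf_ofBasis
  obtain ⟨p, hp, hcoarse⟩ :=
    (POVM.IsCoarseningOf.tensorPOVM hψ).exists_coarse_eq_integral hρ.1
  have hsum : ∑ i, p i = 1 := by
    have htrace := ((tensorPOVM P).isState_coarse hρ).2
    rw [hcoarse, trace_integral_tensorPOVM_ofBasis ψ p] at htrace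
    exact_mod_cast htrace
  exact ⟨ψ, p, hp, hsum, hcoarse.trans (integral_tensorPOVM_ofBasis ψ p)⟩

theorem gap_LOstar_le_relEntQuantumness (hρ : IsState ρ) :
    gap (LOstar d) ρ ≤ relEntQuantumness ρ := by
  refine gap_le_relEntropyDist ?_
  rintro σ ⟨ψ, p, hp, hsum, rfl⟩
  have hproj (k : Fin n) : (POVM.ofBasis (ψ k)).IsProjective := POVM.isProjective_ofBasis _
  refine ⟨_, ⟨_, hproj, rfl⟩, ?_⟩
  rw [← integral_tensorPOVM_ofBasis]
  refine (POVM.IsProjective.tensorPOVM hproj).le_relEntropy_integral hρ hp ?_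
  rw [trace_integral_tensorPOVM_ofBasis, hsum, Complex.ofReal_one]

end ClassicallyCorrelated

section Separable

theorem IsState.nonempty {X : Type} [Fintype X] {ρ : Matrix X X ℂ} (hρ : IsState ρ) :
    Nonempty X := by
  by_contra hX
  rw [not_nonempty_iff] at hX
  simpa [trace] using hρ.2

theorem exists_isState_eq_trace_smul {X : Type} [Fintype X] [Nonempty X] {A : Matrix X X ℂ}
    (hA : A.PosSemidef) : ∃ τ, IsState τ ∧ A = A.trace.re • τ := by
  classical
  have htrace : (A.trace.re : ℂ) = A.trace := (Complex.eq_re_of_ofReal_le hA.trace_nonneg).symm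
  by_cases h : A.trace.re = 0
  · have hA0 : A = 0 := by rw [← hA.trace_eq_zero_iff, ← htrace, h, Complex.ofReal_zero]
    refine ⟨(Fintype.card X : ℝ)⁻¹ • 1, ⟨PosSemidef.one.smul (by positivity), ?_⟩, by simp [hA0]⟩
    simp [trace_smul, trace_one]
  · refine ⟨A.trace.re⁻¹ • A, ⟨hA.smul ?_, ?_⟩, (smul_inv_smul₀ h A).symm⟩
    · exact inv_nonneg.mpr (Complex.le_def.mp hA.trace_nonneg).1
    · rw [trace_smul, ← htrace, Complex.real_smul, ← Complex.ofReal_mul, Complex.ofReal_re,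
        inv_mul_cancel₀ h, Complex.ofReal_one]

variable {n : ℕ} {d : Fin n → ℕ} {ρ : Matrix (Idx d) (Idx d) ℂ}

theorem exists_tensorOp_eq_smul_tensorOp_isState [Nonempty (Idx d)]
    {B : (k : Fin n) → Matrix (Fin (d k)) (Fin (d k)) ℂ} (hB : ∀ k, (B k).PosSemidef) :
    ∃ w : ℝ, 0 ≤ w ∧ ∃ τ : (k : Fin n) → Matrix (Fin (d k)) (Fin (d k)) ℂ,
      (∀ k, IsState (τ k)) ∧ tensorOp B = w • tensorOp τ := by
  have hne (k : Fin n) : Nonempty (Fin (d k)) := ‹Nonempty (Idx d)›.map fun x => x k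
  choose τ hτ hBτ using fun k => exists_isState_eq_trace_smul (hB k)
  refine ⟨∏ k, (B k).trace.re, Finset.prod_nonneg fun k _ => ?_, τ, hτ, ?_⟩
  · exact (Complex.le_def.mp (hB k).trace_nonneg).1
  · rw [← tensorOp_smul, ← funext hBτ]

theorem sum_smul_tensorOp_mem_sepStates {ι : Type*} [Fintype ι] {p : ι → ℝ} (hp : ∀ j, 0 ≤ p j)
    {τ : ι → (k : Fin n) → Matrix (Fin (d k)) (Fin (d k)) ℂ} (hτ : ∀ j k, IsState (τ j k))
    (h : (∑ j, p j • tensorOp (τ j)).trace = 1) :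
    ∑ j, p j • tensorOp (τ j) ∈ sepStates d := by
  have htrace (j : ι) : (tensorOp (τ j)).trace = 1 := by
    rw [trace_tensorOp, Finset.prod_eq_one fun k _ => (hτ j k).2]
  have hsum : ∑ j, p j = 1 := by
    simp only [trace_sum, trace_smul, htrace, Complex.real_smul, mul_one] at h
    exact_mod_cast h
  let e := (Fintype.equivFin ι).symm
  refine ⟨Fintype.card ι, p ∘ e, τ ∘ e, fun j => hp (e j), ?_, fun j => hτ (e j), ?_⟩
  · rw [← hsum]
    exact e.sum_comp p
  · simpa using (e.sum_comp fun j => p j • tensorOp (τ j)).symm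

theorem coarse_mem_sepStates (hρ : IsState ρ) {M : POVM (Idx d)} (hM : M ∈ SEP d) :
    M.coarse ρ ∈ sepStates d := by
  have := hρ.nonempty
  choose m B hB hop using hM
  choose w hw τ hτ hBτ using fun i j => exists_tensorOp_eq_smul_tensorOp_isState (hB i j)
  let p : ((i : M.Outcome) × Fin (m i)) → ℝ := fun j =>
    M.prob ρ j.1 / M.volume j.1 * w j.1 j.2
  have hp (j) : 0 ≤ p j := mul_nonneg (M.prob_div_volume_nonneg hρ.1 j.1) (hw j.1 j.2)
  have hcoarse : M.coarse ρ = ∑ j, p j • tensorOp (τ j.1 j.2) := by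
    simp only [p, POVM.coarse, POVM.integral_apply, hop, hBτ, Finset.smul_sum, smul_smul,
      Fintype.sum_sigma]
  have htrace := (M.isState_coarse hρ).2
  rw [hcoarse] at htrace ⊢
  exact sum_smul_tensorOp_mem_sepStates hp (fun j => hτ j.1 j.2) htrace

end Separable

section PartialTranspose

variable {n : ℕ} {d : Fin n → ℕ} {ρ : Matrix (Idx d) (Idx d) ℂ}

theorem partialTranspose_integral (S : Finset (Fin n)) (M : POVM (Idx d)) (c : M.Outcome → ℝ) :
    partialTranspose S (M.integral c) = ∑ i, c i • partialTranspose S (M.op i) := by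
  ext x y
  simp only [partialTranspose, POVM.integral_apply, of_apply, Matrix.sum_apply, Matrix.smul_apply]

theorem coarse_mem_pptStates (hρ : IsState ρ) {M : POVM (Idx d)} (hM : M ∈ PPT d) :
    M.coarse ρ ∈ pptStates d := by
  refine ⟨M.isState_coarse hρ, fun S => ?_⟩
  rw [POVM.coarse, partialTranspose_integral]
  exact posSemidef_sum _ fun i _ => (hM i S).smul (M.prob_div_volume_nonneg hρ.1 i)

end PartialTranspose

end EntropyGap

theorem mainTheorem3 {n : ℕ} (d : Fin n → ℕ)
    (ρ : Matrix (EntropyGap.Idx d) (EntropyGap.Idx d) ℂ) (hρ : EntropyGap.IsState ρ) :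
    EntropyGap.gap (EntropyGap.LOstar d) ρ = EntropyGap.relEntQuantumness ρ ∧
      EntropyGap.gap (EntropyGap.SEP d) ρ ≥ EntropyGap.relEntEntanglement ρ ∧
      EntropyGap.gap (EntropyGap.PPT d) ρ ≥ EntropyGap.relEntEntanglementPPT ρ :=
  ⟨le_antisymm (EntropyGap.gap_LOstar_le_relEntQuantumness hρ)
      (EntropyGap.relEntropyDist_le_gap hρ.1 fun _ => EntropyGap.coarse_mem_ccStates hρ),
    EntropyGap.relEntropyDist_le_gap hρ.1 fun _ => EntropyGap.coarse_mem_sepStates hρ,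
    EntropyGap.relEntropyDist_le_gap hρ.1 fun _ => EntropyGap.coarse_mem_pptStates hρ⟩
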